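/- Let $k,i,n,m$ be integers with $1\le i\le k$ and $n,m\ge 0$. *Paths.* A lattice path starts at a point $(0,a)$ with $a\ge 0$ an integer, ends on the $x$-axis, and consists of finitely many moves, each either $\alpha:(x,y)\to(x+1,\max(0,y-1))$ or $\beta:(x,y)\to(x+1,y+1)$; its last move (if any) is not a horizontal move along the $x$-axis. A peak is a point of the path that is reached by a move $\beta$ and left by a move $\alpha$. The weight of a path is the sum of the $x$-coordinates of its peaks. The charge of a peak $(x,y)$ is the largest integer $c$ for which there are two points $(x',y-c)$ and $(x'',y-c)$ on the path with $x'<x<x''$ such that between these two points there is no peak of height larger than $y$ and every other peak of height $y$ has $x$-coordinate larger than $x$. The total charge of a path is the sum of the charges of its peaks. Let $P_{k,i}(n,m)$ be the number of lattice paths of weight $n$ and total charge $m$ that start at $(0,k-i)$ and all of whose peaks have height at most $k-1$. *Multiple partitions.* Let $G_{k,i}(n,m)$ be the number of tuples $(n^{(1)},\dots,n^{(k-1)})$ of finite (possibly empty) sequences of positive integers $n^{(j)}=(n^{(j)}_1,\dots,n^{(j)}_{m_j})$ such that, for all $1\le j\le k-1$, $$n^{(j)}_\ell\ \ge\ n^{(j)}_{\ell+1}+2j\quad(1\le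 \ell<m_j),\qquad n^{(j)}_{m_j}\ \ge\ j+\max(j-i+1,0)+2j\,(m_{j+1}+\cdots+m_{k-1})\quad\text{if } m_j\ge 1,$$ and $$\sum_{j=1}^{k-1}\sum_{\ell=1}^{m_j} n^{(j)}_\ell=n,\qquad \sum_{j=1}^{k-1} j\,m_j=m .$$ Then both numbers are finite and $$P_{k,i}(n,m)=G_{k,i}(n,m).$$ -/

import Mathlib

/-- The two moves of a lattice path: `alpha` goes from `(x, y)` to `(x + 1, max (0, y - 1))`,
`beta` goes from `(x, y)` to `(x + 1, y + 1)`. -/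
inductive Step : Type
  | alpha : Step
  | beta : Step
deriving DecidableEq

/-- The effect of a move on the height. Subtraction on `ℕ` is truncated, so that
`y - 1` is `max (0, y - 1)`. -/
def Step.move : Step → ℕ → ℕ
  | Step.alpha, y => y - 1
  | Step.beta, y => y + 1

/-- The height at abscissa `x` of the path that starts at `(0, a)` and follows the word `w`;
it is meaningful for `x ≤ w.length`. -/
def pathHeight (a : ℕ) (w : List Step) (x : ℕ) : ℕ :=
  (w.take x).foldl (fun y s => s.move y) a

/-- The point at abscissa `x` is a peak: it is reached by a `beta` and left by an `alpha`. -/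
def IsPeak (w : List Step) (x : ℕ) : Prop :=
  0 < x ∧ w[x - 1]? = some Step.beta ∧ w[x]? = some Step.alpha

instance (w : List Step) : DecidablePred (IsPeak w) := fun x => by
  unfold IsPeak
  infer_instance

/-- The abscissas of the peaks. -/
def peaks (w : List Step) : Finset ℕ :=
  (Finset.range w.length).filter (IsPeak w)

/-- `c` is admissible for the peak at abscissa `x`, of height `y`: there are points `(x', y - c)` and
`(x'', y - c)` on the path, with `x' < x < x''`, such that between them there is no peak
of height larger than `y`, and the other peaks of height `y` lie to the right of `x`. -/
def ChargeAdmissible (a : ℕ) (w : List Step) (x c : ℕ) : Prop :=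
  ∃ x' x'' : ℕ, x' < x ∧ x < x'' ∧ x'' ≤ w.length ∧
    pathHeight a w x' + c = pathHeight a w x ∧
    pathHeight a w x'' + c = pathHeight a w x ∧
    ∀ z ∈ peaks w, x' < z → z < x'' → z ≠ x →
      pathHeight a w z ≤ pathHeight a w x ∧
        (pathHeight a w z = pathHeight a w x → x < z)

/-- The charge of the peak at abscissa `x`: the largest admissible `c`. (For a peak, `c = 1` is
admissible, and every admissible `c` is at most the height of the peak.) -/
noncomputable def charge (a : ℕ) (w : List Step) (x : ℕ) : ℕ :=
  sSup {c : ℕ | ChargeAdmissible a w x c}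

/-- The weight of a path: the sum of the abscissas of its peaks. -/
def pathWeight (w : List Step) : ℕ :=
  ∑ x ∈ peaks w, x

/-- The total charge of a path. -/
noncomputable def totalCharge (a : ℕ) (w : List Step) : ℕ :=
  ∑ x ∈ peaks w, charge a w x

/-- The word `w` describes a lattice path from `(0, a)` to the horizontal axis, all of whose peaks
have height at most `h`. The last move, if there is one, is not a horizontal move along the axis:
otherwise a path could be prolonged by any number of such moves. -/
structure IsRestrictedPath (a h : ℕ) (w : List Step) : Prop where
  ends_on_axis : pathHeight a w w.length = 0
  last_not_horizontal : ∀ t, t + 1 = w.length → pathHeight a w t ≠ 0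
  peak_le : ∀ x ∈ peaks w, pathHeight a w x ≤ h

/-- The restricted lattice paths counted by `P_{k,i}(n,m)`. -/
def restrictedPaths (k i n m : ℕ) : Set (List Step) :=
  {w | IsRestrictedPath (k - i) (k - 1) w ∧ pathWeight w = n ∧ totalCharge (k - i) w = m}

/-- The number `P_{k,i}(n,m)`. -/
noncomputable def numPaths (k i n m : ℕ) : ℕ :=
  (restrictedPaths k i n m).ncard

/-- The conditions on a multiple partition `(n^(1), …, n^(k-1))`. The partition `n^(j)` is
`p ⟨j - 1, _⟩`, listed from its largest part `n^(j)_1` to its smallest part. -/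
structure IsMultiplePartition (k i : ℕ) (p : Fin (k - 1) → List ℕ) : Prop where
  /-- `n^(j)_l ≥ n^(j)_{l+1} + 2 j`. -/
  gap : ∀ j : Fin (k - 1), (p j).IsChain (fun x y => x ≥ y + 2 * (j.val + 1))
  /-- The smallest part of `n^(j)`, if there is one, is at least
  `j + max (j - i + 1, 0) + 2 j (m_{j+1} + ⋯ + m_{k-1})`. -/
  smallest : ∀ j : Fin (k - 1), ∀ x ∈ (p j).getLast?,
    (x : ℤ) ≥ ((j.val + 1 : ℕ) : ℤ) + max (((j.val + 1 : ℕ) : ℤ) - (i : ℤ) + 1) 0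
      + 2 * ((j.val + 1 : ℕ) : ℤ) * ((∑ l ∈ Finset.Ioi j, (p l).length : ℕ) : ℤ)

/-- The multiple partitions counted by `G_{k,i}(n,m)`: the sum of all parts is `n`, and
`∑ j, j * m_j = m`. -/
def multiplePartitions (k i n m : ℕ) : Set (Fin (k - 1) → List ℕ) :=
  {p | IsMultiplePartition k i p ∧ ∑ j, (p j).sum = n ∧
    ∑ j, (j.val + 1) * (p j).length = m}

/-- The number `G_{k,i}(n,m)`. -/
noncomputable def numMultiplePartitions (k i n m : ℕ) : ℕ :=
  (multiplePartitions k i n m).ncard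

/-! Continue the word of a path by infinitely many moves `alpha` and delete the factors
`beta alpha` at all its peaks. Each peak of the shrunk word comes from at least one peak of the
original word, and the leftmost of these has its charge lowered by one, while all other
deleted peaks have charge one. So the total charge drops by the number `M_1` of peaks. The
original word is determined by the shrunk word and the multiset of the abscissas in it at which
factors were deleted; this multiset has to contain every peak of the shrunk word and is otherwise
arbitrary. The `r`-th deleted factor had `2 r - 2` deleted moves before it, so the sum of the
peaks is the sum of the multiset plus `1 + 3 + ⋯ + (2 M_1 - 1) = M_1 ^ 2`.

Shrinking lowers the height bound by one. When the start has the maximal height, the first move is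
forced to be `alpha`; dropping it moves every peak by one and changes no charge. After `k - 1`
rounds the path is encoded by arbitrary multisets `f_1, …, f_{k-1}`, and with `m_j = |f_j|` and
`M_j = m_j + ⋯ + m_{k-1}` it has total charge `M_1 + ⋯ + M_{k-1} = ∑ j m_j` and weight
`∑ sum f_j + M_1 ^ 2 + ⋯ + M_{k-1} ^ 2 + M_i + ⋯ + M_{k-1}`. Adding to each `f_j`, in decreasing
order, the smallest sequence allowed as `n^(j)` for the given `m_j, …, m_{k-1}` turns these
tuples into the multiple partitions, with the same weight and charge. -/

namespace LatticePath

open Step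

/-! ### Words continued by infinitely many moves `alpha` -/

/-- The move at abscissa `x` of the word `w` continued by moves `alpha`. In this way a word stands
for a path that never stops, and trailing moves `alpha` are irrelevant. -/
def stepAt (w : List Step) (x : ℕ) : Step := w.getD x alpha

/-- The height at abscissa `x` of the path that starts at `(0, a)` and follows the word `w`
continued by moves `alpha`. In contrast to `pathHeight`, it is meaningful for every `x`. -/
def height (a : ℕ) (w : List Step) : ℕ → ℕ
  | 0 => a
  | x + 1 => (stepAt w x).move (height a w x)

/-- The abscissas of the peaks of the word `w` continued by moves `alpha`: a final `beta` of `w` is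
followed by a peak, which `peaks w` does not contain. -/
def peakSet (w : List Step) : Finset ℕ :=
  {x ∈ Finset.range (w.length + 1) | 0 < x ∧ stepAt w (x - 1) = beta ∧ stepAt w x = alpha}

section Heights

variable {a b : ℕ} {v w : List Step} {s : Step} {p q u x : ℕ}

lemma eq_beta_of_ne_alpha (h : s ≠ alpha) : s = beta := by
  cases s <;> trivial

lemma eq_alpha_of_ne_beta (h : s ≠ beta) : s = alpha := by
  cases s <;> trivial

@[simp] lemma stepAt_nil (x : ℕ) : stepAt [] x = alpha := rfl

@[simp] lemma stepAt_cons_zero (s : Step) (r : List Step) : stepAt (s :: r) 0 = s := rfl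

@[simp] lemma stepAt_cons_succ (s : Step) (r : List Step) (x : ℕ) :
    stepAt (s :: r) (x + 1) = stepAt r x := rfl

@[simp] lemma stepAt_tail (w : List Step) (x : ℕ) : stepAt w.tail x = stepAt w (x + 1) := by
  cases w <;> rfl

lemma stepAt_of_length_le (h : w.length ≤ x) : stepAt w x = alpha :=
  List.getD_eq_default _ _ h

lemma lt_length_of_stepAt_eq_beta (h : stepAt w x = beta) : x < w.length := by
  by_contra hx
  simp [stepAt_of_length_le (not_lt.1 hx)] at h

@[simp] lemma height_zero (a : ℕ) (w : List Step) : height a w 0 = a := rfl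

lemma height_succ_of_beta (h : stepAt w x = beta) : height a w (x + 1) = height a w x + 1 := by
  rw [height, h, Step.move]

lemma height_succ_of_alpha (h : stepAt w x = alpha) : height a w (x + 1) = height a w x - 1 := by
  rw [height, h, Step.move]

lemma height_succ_le (a : ℕ) (w : List Step) (x : ℕ) : height a w (x + 1) ≤ height a w x + 1 := by
  rw [height]
  cases stepAt w x <;> simp only [Step.move] <;> omega

lemma height_le_succ (a : ℕ) (w : List Step) (x : ℕ) : height a w x ≤ height a w (x + 1) + 1 := by
  rw [height]
  cases stepAt w x <;> simp only [Step.move] <;> omega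

lemma height_succ_eq_height_tail (a : ℕ) (w : List Step) (x : ℕ) :
    height a w (x + 1) = height ((stepAt w 0).move a) w.tail x := by
  induction x with
  | zero => rfl
  | succ x ih => rw [height, ih, height, stepAt_tail]

@[simp] lemma height_cons_succ (a : ℕ) (s : Step) (r : List Step) (x : ℕ) :
    height a (s :: r) (x + 1) = height (s.move a) r x :=
  height_succ_eq_height_tail a (s :: r) x

lemma height_length_add (a : ℕ) (w : List Step) (n : ℕ) :
    height a w (w.length + n) = height a w w.length - n := by
  induction n with
  | zero => rfl
  | succ n ih =>
    rw [← add_assoc, height_succ_of_alpha (stepAt_of_length_le (by omega)), ih, Nat.sub_sub]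

lemma height_congr (h : stepAt w = stepAt v) : height a w = height a v := by
  funext x
  induction x with
  | zero => rfl
  | succ x ih => rw [height, height, ih, h]

lemma mem_peakSet : x ∈ peakSet w ↔ 0 < x ∧ stepAt w (x - 1) = beta ∧ stepAt w x = alpha := by
  refine ⟨fun h => (Finset.mem_filter.1 h).2, fun h => Finset.mem_filter.2 ⟨?_, h⟩⟩
  have := lt_length_of_stepAt_eq_beta h.2.1
  exact Finset.mem_range.2 (by omega)

@[simp] lemma succ_mem_peakSet :
    x + 1 ∈ peakSet w ↔ stepAt w x = beta ∧ stepAt w (x + 1) = alpha := by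
  simp [mem_peakSet]

@[simp] lemma zero_notMem_peakSet (w : List Step) : 0 ∉ peakSet w := by
  simp [mem_peakSet]

lemma peakSet_congr (h : stepAt w = stepAt v) : peakSet w = peakSet v := by
  ext x
  rw [mem_peakSet, mem_peakSet, h]

lemma height_of_mem_peakSet (hx : x ∈ peakSet w) : height a w x = height a w (x - 1) + 1 := by
  obtain ⟨hpos, hbeta, -⟩ := mem_peakSet.1 hx
  rw [← height_succ_of_beta hbeta, Nat.sub_add_cancel hpos]

lemma height_succ_of_mem_peakSet (hx : x ∈ peakSet w) :
    height a w (x + 1) = height a w x - 1 :=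
  height_succ_of_alpha (mem_peakSet.1 hx).2.2

lemma succ_mem_peakSet_of_height_le (hpos : 0 < height a w (x + 1))
    (hleft : height a w x ≤ height a w (x + 1))
    (hright : height a w (x + 2) ≤ height a w (x + 1)) : x + 1 ∈ peakSet w := by
  refine succ_mem_peakSet.2 ⟨eq_beta_of_ne_alpha fun h => ?_, eq_alpha_of_ne_beta fun h => ?_⟩
  · have := height_succ_of_alpha (a := a) h
    omega
  · have : height a w (x + 2) = height a w (x + 1) + 1 := height_succ_of_beta h
    omega

lemma exists_mem_peakSet_between (hpu : p ≤ u) (huq : u ≤ q)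
    (hp : height a w p < height a w u) (hq : height a w q < height a w u) :
    ∃ z ∈ peakSet w, p < z ∧ z < q ∧ height a w u ≤ height a w z := by
  have hu : u ∈ Finset.Icc p q := Finset.mem_Icc.2 ⟨hpu, huq⟩
  obtain ⟨z, hz, hmax⟩ := Finset.exists_max_image _ (height a w) ⟨u, hu⟩
  rw [Finset.mem_Icc] at hz
  have huz := hmax u hu
  have hpz : p < z := hz.1.lt_of_ne (by rintro rfl; omega)
  have hzq : z < q := hz.2.lt_of_ne (by rintro rfl; omega)
  refine ⟨z, ?_, hpz, hzq, huz⟩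
  obtain ⟨z, rfl⟩ := Nat.exists_eq_add_one_of_ne_zero (Nat.ne_zero_of_lt hpz)
  exact succ_mem_peakSet_of_height_le (by omega)
    (hmax z (Finset.mem_Icc.2 ⟨by omega, by omega⟩))
    (hmax (z + 2) (Finset.mem_Icc.2 ⟨by omega, by omega⟩))

lemma height_le_of_forall_mem_peakSet (ha : a ≤ b) (hw : ∀ z ∈ peakSet w, height a w z ≤ b)
    (x : ℕ) : height a w x ≤ b := by
  by_contra! hx
  have hend : height a w (w.length + (height a w w.length + x)) = 0 := by
    rw [height_length_add]
    omega
  obtain ⟨z, hz, -, -, hxz⟩ := exists_mem_peakSet_between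
    (q := w.length + (height a w w.length + x)) (Nat.zero_le x) (by omega) (ha.trans_lt hx)
    (by omega)
  exact absurd (hw z hz) (by omega)

end Heights

/-! ### Charges -/

/-- No peak strictly between `p` and `q` is higher than the point at `x`, and the other ones of the
same height lie to the right of `x`: the condition on the peaks in the definition of the charge. -/
def IsLeftmostHighest (a : ℕ) (w : List Step) (p x q : ℕ) : Prop :=
  ∀ z ∈ peakSet w, p < z → z < q → z ≠ x →
    height a w z ≤ height a w x ∧ (height a w z = height a w x → x < z)

/-- The counterpart of `ChargeAdmissible` for words continued by moves `alpha`, for positive `c`.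
The two points are only required to have height at most the height of the peak minus `c`;
since heights change by at most one at each move, this does not change the charge. -/
def Admissible (a : ℕ) (w : List Step) (x c : ℕ) : Prop :=
  1 ≤ c ∧ ∃ p q, p < x ∧ x < q ∧ height a w p + c ≤ height a w x ∧
    height a w q + c ≤ height a w x ∧ IsLeftmostHighest a w p x q

/-- The charge of the peak at `x` of a word continued by moves `alpha`. -/
noncomputable def peakCharge (a : ℕ) (w : List Step) (x : ℕ) : ℕ :=
  sSup {c | Admissible a w x c}

/-- The total charge of a word continued by moves `alpha`. -/
noncomputable def wordCharge (a : ℕ) (w : List Step) : ℕ :=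
  ∑ x ∈ peakSet w, peakCharge a w x

section Charges

variable {a : ℕ} {w : List Step} {p q u x c : ℕ}

lemma IsLeftmostHighest.height_le (h : IsLeftmostHighest a w p x q)
    (hp : height a w p ≤ height a w x) (hq : height a w q ≤ height a w x)
    (hpu : p ≤ u) (huq : u ≤ q) : height a w u ≤ height a w x := by
  by_contra! hu
  obtain ⟨z, hz, hpz, hzq, huz⟩ :=
    exists_mem_peakSet_between hpu huq (hp.trans_lt hu) (hq.trans_lt hu)
  exact absurd (h z hz hpz hzq (by rintro rfl; omega)).1 (by omega)

lemma IsLeftmostHighest.mem_peakSet (h : IsLeftmostHighest a w p x q) (hpx : p < x) (hxq : x < q)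
    (hp : height a w p < height a w x) (hq : height a w q < height a w x) : x ∈ peakSet w := by
  obtain ⟨x, rfl⟩ := Nat.exists_eq_add_one_of_ne_zero (Nat.ne_zero_of_lt hpx)
  exact succ_mem_peakSet_of_height_le (by omega)
    (h.height_le hp.le hq.le (by omega) (by omega)) (h.height_le hp.le hq.le (by omega) hxq)

lemma IsLeftmostHighest.height_lt (h : IsLeftmostHighest a w p x q) (hx : x ∈ peakSet w)
    (hxq : x < q) (hp : height a w p < height a w x) (hpu : p ≤ u) (hux : u < x) :
    height a w u < height a w x := by
  have hx' := height_of_mem_peakSet (a := a) hx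
  by_contra! hu
  obtain ⟨z, hz, hpz, hzx, huz⟩ :=
    exists_mem_peakSet_between hpu (Nat.le_sub_one_of_lt hux) (hp.trans_le hu) (by omega)
  have := h z hz hpz (by omega) (by omega)
  omega

lemma admissible_one (hx : x ∈ peakSet w) : Admissible a w x 1 := by
  have hpos := (mem_peakSet.1 hx).1
  have hleft := height_of_mem_peakSet (a := a) hx
  have hright := height_succ_of_mem_peakSet (a := a) hx
  exact ⟨le_rfl, x - 1, x + 1, by omega, by omega, by omega, by omega, fun z _ _ _ _ => by omega⟩

lemma Admissible.le_height (h : Admissible a w x c) : c ≤ height a w x := by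
  obtain ⟨-, p, q, -, -, hp, -⟩ := h
  omega

lemma isGreatest_peakCharge (hx : x ∈ peakSet w) :
    IsGreatest {c | Admissible a w x c} (peakCharge a w x) := by
  have hb : BddAbove {c | Admissible a w x c} := ⟨height a w x, fun c hc => hc.le_height⟩
  exact ⟨Nat.sSup_mem ⟨1, admissible_one hx⟩ hb, fun c hc => le_csSup hb hc⟩

end Charges

/-! ### Flattening the peaks -/

/-- The path of `v` arises from the path of `w` by lowering every peak by one and contracting
abscissas along `φ`, where over each peak of `v` there is at least one peak of `w`. -/
structure IsFlattening (a : ℕ) (w v : List Step) (φ : ℕ → ℕ) : Prop where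
  mono : Monotone φ
  height_eq : ∀ t, height a w t = height a v (φ t) + if t ∈ peakSet w then 1 else 0
  exists_notMem_peakSet : ∀ x, ∃ t, t ∉ peakSet w ∧ φ t = x
  exists_mem_peakSet : ∀ x ∈ peakSet v, ∃ t ∈ peakSet w, φ t = x

lemma sum_filter_forall_lt_ne {ι κ M : Type*} [LinearOrder ι] [DecidableEq κ] [AddCommMonoid M]
    {s : Finset ι} {T : Finset κ} {φ : ι → κ} (hT : ∀ x ∈ T, ∃ t ∈ s, φ t = x) (g : κ → M) :
    ∑ t ∈ s with φ t ∈ T ∧ ∀ t' ∈ s, t' < t → φ t' ≠ φ t, g (φ t) = ∑ x ∈ T, g x := by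
  refine Finset.sum_nbij φ (fun t ht => (Finset.mem_filter.1 ht).2.1) ?_ ?_ fun _ _ => rfl
  · intro t ht t' ht' he
    obtain ⟨hts, -, hfirst⟩ := Finset.mem_filter.1 ht
    obtain ⟨hts', -, hfirst'⟩ := Finset.mem_filter.1 ht'
    exact le_antisymm (not_lt.1 fun h => hfirst t' hts' h he.symm)
      (not_lt.1 fun h => hfirst' t hts h he)
  · intro x hx
    obtain ⟨t₀, ht₀, rfl⟩ := hT x hx
    obtain ⟨t, ht, hmin⟩ := Finset.exists_min_image {t ∈ s | φ t = φ t₀} id ⟨t₀, by simp [ht₀]⟩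
    obtain ⟨hts, hφ⟩ := Finset.mem_filter.1 ht
    refine ⟨t, Finset.mem_filter.2 ⟨hts, by rwa [hφ], fun t' ht' hlt he => ?_⟩, hφ⟩
    exact (hmin t' (Finset.mem_filter.2 ⟨ht', he.trans hφ⟩)).not_gt hlt

namespace IsFlattening

variable {a : ℕ} {w v : List Step} {φ : ℕ → ℕ} {p q t t' c : ℕ}

lemma height_of_mem (H : IsFlattening a w v φ) (ht : t ∈ peakSet w) :
    height a w t = height a v (φ t) + 1 := by
  rw [H.height_eq, if_pos ht]

lemma height_of_notMem (H : IsFlattening a w v φ) (ht : t ∉ peakSet w) :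
    height a w t = height a v (φ t) := by
  rw [H.height_eq, if_neg ht, add_zero]

lemma height_le (H : IsFlattening a w v φ) (t : ℕ) : height a v (φ t) ≤ height a w t := by
  rw [H.height_eq]
  exact Nat.le_add_right _ _

lemma isLeftmostHighest_map (H : IsFlattening a w v φ) (ht : t ∈ peakSet w)
    (h : IsLeftmostHighest a w p t q) : IsLeftmostHighest a v (φ p) (φ t) (φ q) := by
  intro z hz hpz hzq hne
  obtain ⟨u, hu, rfl⟩ := H.exists_mem_peakSet z hz
  have := h u hu (H.mono.reflect_lt hpz) (H.mono.reflect_lt hzq) (by rintro rfl; exact hne rfl)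
  rw [H.height_of_mem hu, H.height_of_mem ht] at this
  exact ⟨by omega, fun he => (H.mono (this.2 (by omega)).le).lt_of_ne hne.symm⟩

lemma map_ne_of_isLeftmostHighest (H : IsFlattening a w v φ) (ht : t ∈ peakSet w)
    (h : IsLeftmostHighest a w p t q) (hp : φ p < φ t) (htq : t < q) (ht' : t' ∈ peakSet w)
    (hlt : t' < t) : φ t' ≠ φ t := by
  intro he
  have := h t' ht' (H.mono.reflect_lt (he ▸ hp)) (hlt.trans htq) hlt.ne
  rw [H.height_of_mem ht', H.height_of_mem ht, he] at this
  omega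

lemma isLeftmostHighest_of_map (H : IsFlattening a w v φ) (ht : t ∈ peakSet w)
    (htv : φ t ∈ peakSet v) (hfirst : ∀ t' ∈ peakSet w, t' < t → φ t' ≠ φ t)
    (h : IsLeftmostHighest a v (φ p) (φ t) (φ q)) (hq : φ t < φ q)
    (hhp : height a v (φ p) < height a v (φ t)) (hhq : height a v (φ q) < height a v (φ t)) :
    IsLeftmostHighest a w p t q := by
  intro z hz hpz hzq hne
  rw [H.height_of_mem hz, H.height_of_mem ht]
  have hpz' := H.mono hpz.le
  rcases lt_trichotomy (φ z) (φ t) with hlt | heq | hgt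
  · have := h.height_lt htv hq hhp hpz' hlt
    omega
  · rw [heq]
    exact ⟨le_rfl, fun _ => hne.symm.lt_of_le (not_lt.1 fun hlt => hfirst z hz hlt heq)⟩
  · have := h.height_le hhp.le hhq.le hpz' (H.mono hzq.le)
    exact ⟨by omega, fun _ => H.mono.reflect_lt hgt⟩

lemma admissible_succ_iff (H : IsFlattening a w v φ) (ht : t ∈ peakSet w) (hc : 1 ≤ c) :
    Admissible a w t (c + 1) ↔
      (φ t ∈ peakSet v ∧ ∀ t' ∈ peakSet w, t' < t → φ t' ≠ φ t) ∧ Admissible a v (φ t) c := by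
  have hht := H.height_of_mem ht
  constructor
  · rintro ⟨-, p, q, hpt, htq, hp, hq, h⟩
    have hp' := H.height_le p
    have hq' := H.height_le q
    have hφp : φ p < φ t := (H.mono hpt.le).lt_of_ne fun he => by rw [he] at hp'; omega
    have hφq : φ t < φ q := (H.mono htq.le).lt_of_ne fun he => by rw [← he] at hq'; omega
    have hv := H.isLeftmostHighest_map ht h
    exact ⟨⟨hv.mem_peakSet hφp hφq (by omega) (by omega),
      fun _ ht' hlt => H.map_ne_of_isLeftmostHighest ht h hφp htq ht' hlt⟩,
      hc, φ p, φ q, hφp, hφq, by omega, by omega, hv⟩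
  · rintro ⟨⟨htv, hfirst⟩, -, x, y, hxt, hty, hx, hy, hv⟩
    obtain ⟨p, hp, rfl⟩ := H.exists_notMem_peakSet x
    obtain ⟨q, hq, rfl⟩ := H.exists_notMem_peakSet y
    have hp' := H.height_of_notMem hp
    have hq' := H.height_of_notMem hq
    exact ⟨by omega, p, q, H.mono.reflect_lt hxt, H.mono.reflect_lt hty, by omega, by omega,
      H.isLeftmostHighest_of_map ht htv hfirst hv hty (by omega) (by omega)⟩

open Classical in
lemma peakCharge_eq (H : IsFlattening a w v φ) (ht : t ∈ peakSet w) :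
    peakCharge a w t = 1 + if φ t ∈ peakSet v ∧ ∀ t' ∈ peakSet w, t' < t → φ t' ≠ φ t
      then peakCharge a v (φ t) else 0 := by
  refine (isGreatest_peakCharge ht).unique ⟨?_, fun c hc => ?_⟩
  · split_ifs with h
    · have hv := (isGreatest_peakCharge (a := a) h.1).1
      rw [add_comm]
      exact (H.admissible_succ_iff ht hv.1).2 ⟨h, hv⟩
    · exact admissible_one ht
  · obtain ⟨c, rfl⟩ := Nat.exists_eq_add_of_le' hc.1
    rcases Nat.eq_zero_or_pos c with rfl | hpos
    · exact Nat.le_add_right _ _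
    · obtain ⟨h, hv⟩ := (H.admissible_succ_iff ht hpos).1 hc
      rw [if_pos h, add_comm]
      exact Nat.add_le_add_left ((isGreatest_peakCharge h.1).2 hv) 1

lemma wordCharge_eq (H : IsFlattening a w v φ) :
    wordCharge a w = (peakSet w).card + wordCharge a v := by
  classical
  rw [wordCharge, Finset.sum_congr rfl fun t ht => H.peakCharge_eq ht, Finset.sum_add_distrib,
    ← Finset.sum_filter, sum_filter_forall_lt_ne H.exists_mem_peakSet, ← Finset.card_eq_sum_ones,
    wordCharge]

end IsFlattening

/-! ### Deleting the factors `beta alpha` -/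

/-- Prepend a move to a word, except that prepending `alpha` to the empty word gives the empty word:
no trailing move `alpha` is created. -/
def scons : Step → List Step → List Step
  | alpha, [] => []
  | s, r => s :: r

/-- A word without trailing moves `alpha`. -/
def Canonical (w : List Step) : Prop := w.getLast? ≠ some alpha

/-- The word obtained by deleting all factors `beta alpha` at the peaks of a word continued by moves
`alpha`. -/
def shrink : List Step → List Step
  | [] => []
  | s :: r => if 1 ∈ peakSet (s :: r) then shrink r.tail else scons s (shrink r)
termination_by w => w.length
decreasing_by all_goals grind

/-- The abscissas in `shrink w` at which the factors `beta alpha` of `w` have been deleted. -/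
def bumps : List Step → Multiset ℕ
  | [] => 0
  | s :: r => if 1 ∈ peakSet (s :: r) then 0 ::ₘ bumps r.tail else (bumps r).map (· + 1)
termination_by w => w.length
decreasing_by all_goals grind

/-- The abscissa in `shrink w` of the point of `w` at a given abscissa. -/
def proj : List Step → ℕ → ℕ
  | [], t => t
  | _ :: _, 0 => 0
  | s :: r, t + 1 => if 1 ∈ peakSet (s :: r) then proj r.tail (t - 1) else proj r t + 1
termination_by w => w.length
decreasing_by all_goals grind

section Shrink

variable {r v w : List Step} {x : ℕ}

@[simp] lemma tail_scons (s : Step) (r : List Step) : (scons s r).tail = r := by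
  cases s <;> cases r <;> rfl

lemma stepAt_scons (s : Step) (r : List Step) : stepAt (scons s r) = stepAt (s :: r) := by
  funext x
  cases s <;> cases r <;> cases x <;> rfl

@[simp] lemma stepAt_scons_zero (s : Step) (r : List Step) : stepAt (scons s r) 0 = s := by
  rw [stepAt_scons, stepAt_cons_zero]

@[simp] lemma height_scons (a : ℕ) (s : Step) (r : List Step) :
    height a (scons s r) = height a (s :: r) := height_congr (stepAt_scons s r)

@[simp] lemma canonical_nil : Canonical [] := by
  simp [Canonical]

lemma canonical_beta_cons (h : Canonical r) : Canonical (beta :: r) := by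
  cases r <;> simp_all [Canonical]

lemma canonical_scons (s : Step) (h : Canonical r) : Canonical (scons s r) := by
  cases s <;> cases r <;> simp_all [Canonical, scons]

lemma Canonical.tail (h : Canonical w) : Canonical w.tail := by
  rcases w with _ | ⟨s, _ | _⟩ <;> simp_all [Canonical]

lemma Canonical.scons_tail (h : Canonical w) : scons (stepAt w 0) w.tail = w := by
  rcases w with _ | ⟨_ | _, _ | _⟩ <;> simp_all [Canonical, scons]

lemma Canonical.length_mem_peakSet (h : Canonical w) (hne : w ≠ []) : w.length ∈ peakSet w := by
  have hpos := List.length_pos_iff.2 hne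
  refine mem_peakSet.2 ⟨hpos, eq_beta_of_ne_alpha fun hlast => h ?_, stepAt_of_length_le le_rfl⟩
  rw [stepAt, List.getD_eq_getElem _ _ (Nat.sub_one_lt hpos.ne')] at hlast
  rw [List.getLast?_eq_getElem?, List.getElem?_eq_getElem (Nat.sub_one_lt hpos.ne'), hlast]

lemma one_mem_peakSet : 1 ∈ peakSet w ↔ stepAt w 0 = beta ∧ stepAt w 1 = alpha :=
  succ_mem_peakSet

lemma Canonical.eq_beta_cons (h : Canonical w) (hw : 1 ∈ peakSet w) :
    w = beta :: scons alpha w.tail.tail := by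
  obtain ⟨h0, h1⟩ := one_mem_peakSet.1 hw
  rw [← stepAt_tail] at h1
  rw [← h1, h.tail.scons_tail]
  cases w with
  | nil => simp at hw
  | cons s r => rw [← h0, stepAt_cons_zero, List.tail_cons]

lemma one_mem_peakSet_beta_cons_scons_alpha (r : List Step) :
    1 ∈ peakSet (beta :: scons alpha r) := by
  simp

lemma succ_mem_peakSet_of_mem_peakSet_tail (hx : x ∈ peakSet w.tail) : x + 1 ∈ peakSet w := by
  obtain ⟨hpos, hbeta, halpha⟩ := mem_peakSet.1 hx
  rw [stepAt_tail, Nat.sub_add_cancel hpos] at hbeta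
  exact succ_mem_peakSet.2 ⟨hbeta, stepAt_tail w x ▸ halpha⟩

lemma peakSet_nil : peakSet [] = ∅ := rfl

lemma peakSet_of_one_mem (h : 1 ∈ peakSet w) :
    peakSet w = insert 1 ((peakSet w.tail.tail).map (addRightEmbedding 2)) := by
  obtain ⟨h0, h1⟩ := one_mem_peakSet.1 h
  ext x
  rcases x with _ | _ | _ | x <;> simp [h0, h1]

lemma peakSet_of_one_notMem (h : 1 ∉ peakSet w) :
    peakSet w = (peakSet w.tail).map (addRightEmbedding 1) := by
  ext x
  rcases x with _ | _ | x <;> simp [h]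

lemma shrink_of_one_mem (h : 1 ∈ peakSet w) : shrink w = shrink w.tail.tail := by
  cases w with
  | nil => simp at h
  | cons s r => rw [shrink, if_pos h, List.tail_cons]

lemma shrink_of_one_notMem (h : 1 ∉ peakSet w) :
    shrink w = scons (stepAt w 0) (shrink w.tail) := by
  cases w with
  | nil => simp [shrink, scons]
  | cons s r => rw [shrink, if_neg h, List.tail_cons, stepAt_cons_zero]

lemma bumps_of_one_mem (h : 1 ∈ peakSet w) : bumps w = 0 ::ₘ bumps w.tail.tail := by
  cases w with
  | nil => simp at h
  | cons s r => rw [bumps, if_pos h, List.tail_cons]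

lemma bumps_of_one_notMem (h : 1 ∉ peakSet w) : bumps w = (bumps w.tail).map (· + 1) := by
  cases w with
  | nil => simp [bumps]
  | cons s r => rw [bumps, if_neg h, List.tail_cons]

lemma canonical_shrink (w : List Step) : Canonical (shrink w) := by
  fun_induction shrink w with
  | case1 => exact canonical_nil
  | case2 _ _ _ ih => exact ih
  | case3 s _ _ ih => exact canonical_scons s ih

lemma zero_mem_bumps : 0 ∈ bumps w ↔ 1 ∈ peakSet w := by
  by_cases h : 1 ∈ peakSet w
  · simp [h, bumps_of_one_mem h]
  · simp [h, bumps_of_one_notMem h]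

lemma stepAt_shrink_zero (h : 1 ∉ peakSet w) : stepAt (shrink w) 0 = stepAt w 0 := by
  rw [shrink_of_one_notMem h, stepAt_scons_zero]

lemma card_bumps (w : List Step) : (bumps w).card = (peakSet w).card := by
  fun_induction bumps w with
  | case1 => rfl
  | case2 s r h ih => simp [peakSet_of_one_mem h, ih]
  | case3 s r h ih => simp [peakSet_of_one_notMem h, ih]

lemma sum_peakSet (w : List Step) :
    ∑ x ∈ peakSet w, x = (bumps w).sum + (peakSet w).card ^ 2 := by
  fun_induction bumps w with
  | case1 => rfl
  | case2 s r h ih =>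
    rw [peakSet_of_one_mem h, Finset.sum_insert (by simp), Finset.card_insert_of_notMem (by simp)]
    simp only [List.tail_cons, Finset.sum_map, addRightEmbedding_apply, Finset.sum_add_distrib, ih,
      Finset.sum_const, smul_eq_mul, Multiset.sum_cons, Finset.card_map]
    ring
  | case3 s r h ih =>
    simp only [peakSet_of_one_notMem h, List.tail_cons, Finset.sum_map, addRightEmbedding_apply,
      Finset.sum_add_distrib, ih, Finset.sum_const, smul_eq_mul, mul_one, Multiset.sum_map_add,
      Multiset.map_id', Multiset.map_const', card_bumps, Multiset.sum_replicate, Finset.card_map]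
    ring

lemma mem_bumps_of_mem_peakSet_shrink (hx : x ∈ peakSet (shrink w)) : x ∈ bumps w := by
  fun_induction bumps w generalizing x with
  | case1 => simp [shrink, peakSet_nil] at hx
  | case2 s r h ih =>
    rw [shrink_of_one_mem h] at hx
    exact Multiset.mem_cons_of_mem (ih hx)
  | case3 s r h ih =>
    rw [shrink_of_one_notMem h, List.tail_cons, stepAt_cons_zero] at hx
    obtain ⟨hpos, hbeta, halpha⟩ := mem_peakSet.1 hx
    rw [stepAt_scons] at hbeta halpha
    obtain ⟨y, rfl⟩ := Nat.exists_eq_add_one_of_ne_zero hpos.ne'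
    refine Multiset.mem_map_of_mem _ ?_
    rcases y with _ | y
    · refine zero_mem_bumps.2 (by_contra fun hr => h ?_)
      exact one_mem_peakSet.2 ⟨hbeta, (stepAt_shrink_zero hr).symm.trans halpha⟩
    · exact ih (succ_mem_peakSet.2 ⟨hbeta, halpha⟩)

@[simp] lemma proj_zero (w : List Step) : proj w 0 = 0 := by
  cases w <;> simp [proj]

lemma exists_mem_peakSet_of_mem_bumps (hx : x ∈ bumps w) : ∃ t ∈ peakSet w, proj w t = x := by
  fun_induction bumps w generalizing x with
  | case1 => simp at hx
  | case2 s r h ih =>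
    rcases Multiset.mem_cons.1 hx with rfl | hx
    · exact ⟨1, h, by simp [proj, h]⟩
    · obtain ⟨t, ht, rfl⟩ := ih hx
      exact ⟨t + 2, by simpa [peakSet_of_one_mem h] using ht, by simp [proj, h]⟩
  | case3 s r h ih =>
    obtain ⟨y, hy, rfl⟩ := Multiset.mem_map.1 hx
    obtain ⟨t, ht, rfl⟩ := ih hy
    exact ⟨t + 1, by simpa [peakSet_of_one_notMem h] using ht, by simp [proj, h]⟩

lemma monotone_proj (w : List Step) : Monotone (proj w) := by
  refine monotone_nat_of_le_succ fun t => ?_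
  fun_induction proj w t with
  | case1 t => simp [proj]
  | case2 => exact Nat.zero_le _
  | case3 s r t h ih => cases t <;> simp_all [proj]
  | case4 s r t h ih => simpa [proj, h] using ih

lemma height_eq_proj (a : ℕ) (w : List Step) (t : ℕ) :
    height a w t = height a (shrink w) (proj w t) + if t ∈ peakSet w then 1 else 0 := by
  fun_induction proj w t generalizing a with
  | case1 t => simp [shrink, peakSet_nil]
  | case2 => simp
  | case3 s r t h ih =>
    obtain ⟨rfl, h1⟩ : s = beta ∧ stepAt r 0 = alpha := one_mem_peakSet.1 h
    cases t with
    | zero => simp_all [Step.move]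
    | succ t =>
      rw [height_cons_succ, height_succ_eq_height_tail, h1]
      simpa [shrink_of_one_mem h, peakSet_of_one_mem h, Step.move] using ih a
  | case4 s r t h ih => simp [shrink_of_one_notMem h, ih, peakSet_of_one_notMem h]

lemma exists_notMem_peakSet_proj_eq (w : List Step) (x : ℕ) :
    ∃ t, t ∉ peakSet w ∧ proj w t = x := by
  fun_induction shrink w generalizing x with
  | case1 => exact ⟨x, by simp [peakSet_nil], by rw [proj]⟩
  | case2 s r h ih =>
    obtain ⟨t, ht, rfl⟩ := ih x
    exact ⟨t + 2, by simpa [peakSet_of_one_mem h] using ht, by simp [proj, h]⟩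
  | case3 s r h ih =>
    rcases x with _ | x
    · exact ⟨0, zero_notMem_peakSet _, proj_zero _⟩
    · obtain ⟨t, ht, rfl⟩ := ih x
      exact ⟨t + 1, by simpa [peakSet_of_one_notMem h] using ht, by simp [proj, h]⟩

lemma isFlattening_shrink (a : ℕ) (w : List Step) : IsFlattening a w (shrink w) (proj w) where
  mono := monotone_proj w
  height_eq := height_eq_proj a w
  exists_notMem_peakSet := exists_notMem_peakSet_proj_eq w
  exists_mem_peakSet _ hx := exists_mem_peakSet_of_mem_bumps (mem_bumps_of_mem_peakSet_shrink hx)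

lemma wordCharge_shrink (a : ℕ) (w : List Step) :
    wordCharge a w = (peakSet w).card + wordCharge a (shrink w) :=
  (isFlattening_shrink a w).wordCharge_eq

lemma one_notMem_peakSet_scons_stepAt_zero (hv : ∀ x ∈ peakSet v, x ∈ (bumps w).map (· + 1))
    (h : shrink w = v.tail) : 1 ∉ peakSet (scons (stepAt v 0) w) := by
  intro h1
  rw [one_mem_peakSet, stepAt_scons, stepAt_cons_zero, stepAt_cons_succ] at h1
  have hw : 1 ∉ peakSet w := fun hw => by simp [(one_mem_peakSet.1 hw).1] at h1
  have hv1 : stepAt v 1 = alpha := by rw [← stepAt_tail, ← h, stepAt_shrink_zero hw, h1.2]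
  exact hw (zero_mem_bumps.1 (by simpa using hv 1 (one_mem_peakSet.2 ⟨h1.1, hv1⟩)))

lemma exists_map_succ_eq {s : Multiset ℕ} (h : 0 ∉ s) : ∃ s' : Multiset ℕ, s'.map (· + 1) = s := by
  refine ⟨s.map (· - 1), ?_⟩
  rw [Multiset.map_map]
  exact (Multiset.map_congr rfl fun x hx =>
    Nat.sub_add_cancel (Nat.pos_of_ne_zero (by rintro rfl; exact h hx))).trans s.map_id

theorem exists_shrink_eq_bumps_eq (v : List Step) (s : Multiset ℕ) (hv : Canonical v)
    (hs : ∀ x ∈ peakSet v, x ∈ s) : ∃ w, Canonical w ∧ shrink w = v ∧ bumps w = s := by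
  by_cases h0 : 0 ∈ s
  · obtain ⟨t, ht⟩ := Multiset.exists_cons_of_mem h0
    obtain ⟨w, hw, hwv, hwt⟩ := exists_shrink_eq_bumps_eq v t hv fun x hx =>
      (Multiset.mem_cons.1 (ht ▸ hs x hx)).resolve_left (by rintro rfl; simp at hx)
    have h1 := one_mem_peakSet_beta_cons_scons_alpha w
    refine ⟨beta :: scons alpha w, canonical_beta_cons (canonical_scons _ hw), ?_, ?_⟩
    · rw [shrink_of_one_mem h1, List.tail_cons, tail_scons, hwv]
    · rw [bumps_of_one_mem h1, List.tail_cons, tail_scons, hwt, ht]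
  obtain ⟨t, ht⟩ := exists_map_succ_eq h0
  by_cases hne : v = [] ∧ t = 0
  · exact ⟨[], canonical_nil, by rw [shrink, hne.1],
      by rw [bumps, ← ht, hne.2, Multiset.map_zero]⟩
  obtain ⟨w, hw, hwv, hwt⟩ := exists_shrink_eq_bumps_eq v.tail t hv.tail fun x hx => by
    simpa [← ht] using hs (x + 1) (succ_mem_peakSet_of_mem_peakSet_tail hx)
  rw [← ht, ← hwt] at hs ⊢
  have h1 := one_notMem_peakSet_scons_stepAt_zero hs hwv
  refine ⟨scons (stepAt v 0) w, canonical_scons _ hw, ?_, ?_⟩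
  · rw [shrink_of_one_notMem h1, stepAt_scons_zero, tail_scons, hwv, hv.scons_tail]
  · rw [bumps_of_one_notMem h1, tail_scons]
termination_by v.length + s.sum + s.card
decreasing_by
  · simp [ht]
  · have hpos : 0 < v.length ∨ 0 < t.card := by
      rwa [List.length_pos_iff, Multiset.card_pos, ← not_and_or]
    simp only [← ht, List.length_tail, Multiset.sum_map_add, Multiset.map_id',
      Multiset.map_const', Multiset.sum_replicate, Multiset.card_map, smul_eq_mul, mul_one]
    omega

lemma Canonical.eq_nil_of_bumps_eq_zero (h : Canonical w) (hb : bumps w = 0) : w = [] := by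
  by_contra hne
  have hcard := Finset.card_pos.2 ⟨_, h.length_mem_peakSet hne⟩
  rw [← card_bumps, hb, Multiset.card_zero] at hcard
  exact hcard.false

theorem eq_of_shrink_eq_of_bumps_eq {w w' : List Step} (hw : Canonical w)
    (hw' : Canonical w') (hs : shrink w = shrink w') (hb : bumps w = bumps w') : w = w' := by
  rcases eq_or_ne w [] with rfl | hne
  · exact (hw'.eq_nil_of_bumps_eq_zero (by rw [← hb, bumps])).symm
  have h1 : 1 ∈ peakSet w ↔ 1 ∈ peakSet w' := by rw [← zero_mem_bumps, hb, zero_mem_bumps]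
  by_cases h : 1 ∈ peakSet w
  · rw [shrink_of_one_mem h, shrink_of_one_mem (h1.1 h)] at hs
    rw [bumps_of_one_mem h, bumps_of_one_mem (h1.1 h), Multiset.cons_inj_right] at hb
    rw [hw.eq_beta_cons h, hw'.eq_beta_cons (h1.1 h),
      eq_of_shrink_eq_of_bumps_eq hw.tail.tail hw'.tail.tail hs hb]
  · have h0 := congrArg (stepAt · 0) hs
    have htail := congrArg List.tail hs
    rw [stepAt_shrink_zero h, stepAt_shrink_zero (h1.not.1 h)] at h0
    rw [shrink_of_one_notMem h, shrink_of_one_notMem (h1.not.1 h), tail_scons, tail_scons] at htail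
    rw [bumps_of_one_notMem h, bumps_of_one_notMem (h1.not.1 h)] at hb
    rw [← hw.scons_tail, ← hw'.scons_tail, h0, eq_of_shrink_eq_of_bumps_eq hw.tail hw'.tail htail
      (Multiset.map_injective (add_left_injective 1) hb)]
termination_by w.length
decreasing_by all_goals have := List.length_pos_iff.2 hne; simp only [List.length_tail]; omega

end Shrink

/-! ### Words as tuples of multisets -/

/-- The words without trailing moves `alpha` of the paths from `(0, a)` all of whose peaks have
height at most `h`. -/
def boundedWords (h a : ℕ) : Set (List Step) :=
  {w | Canonical w ∧ ∀ x ∈ peakSet w, height a w x ≤ h}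

/-- The part of `bumps w` that can be chosen freely when `shrink w` is given: `bumps w` contains
every peak of `shrink w` once. -/
def freeBumps (w : List Step) : Multiset ℕ := bumps w - (peakSet (shrink w)).val

/-- The tuple of multisets that encodes a path from `(0, a)` with peaks of height at most `h`: the
free bumps obtained by shrinking its word `h` times. The first move of a path that starts at the
maximal height carries no information; it is dropped before shrinking. -/
def encode : (h : ℕ) → ℕ → List Step → Fin h → Multiset ℕ
  | 0, _, _ => Fin.elim0
  | h + 1, a, w =>
    let u := if a ≤ h then w else w.tail
    Fin.cons (freeBumps u) (encode h (min a h) (shrink u))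

/-- The number of peaks of the path encoded by `f` that remain after shrinking `j` times. -/
def tailCard {h : ℕ} (f : Fin h → Multiset ℕ) (j : Fin h) : ℕ := ∑ l ∈ Finset.Ici j, (f l).card

/-- The sum of the abscissas of the peaks of the path from `(0, a)` encoded by `f`. -/
def tupleWeight {h : ℕ} (a : ℕ) (f : Fin h → Multiset ℕ) : ℕ :=
  ∑ j, ((f j).sum + tailCard f j ^ 2 + if h ≤ j + a then tailCard f j else 0)

section Encoding

variable {h a x c : ℕ} {r w : List Step}

lemma nil_mem_boundedWords (h a : ℕ) : [] ∈ boundedWords h a :=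
  ⟨canonical_nil, by simp [peakSet_nil]⟩

lemma eq_nil_of_mem_boundedWords_zero (hw : w ∈ boundedWords 0 a) : w = [] := by
  by_contra hne
  have hpeak := hw.1.length_mem_peakSet hne
  have hpos := height_of_mem_peakSet (a := a) hpeak
  have := hw.2 _ hpeak
  omega

lemma shrink_mem_boundedWords (ha : a ≤ h) (hw : Canonical w) :
    shrink w ∈ boundedWords h a ↔ w ∈ boundedWords (h + 1) a := by
  have H := isFlattening_shrink a w
  refine ⟨fun hs => ⟨hw, fun x hx => ?_⟩, fun hs => ⟨canonical_shrink w, fun x hx => ?_⟩⟩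
  · rw [H.height_of_mem hx]
    exact Nat.succ_le_succ (height_le_of_forall_mem_peakSet ha hs.2 _)
  · obtain ⟨t, ht, rfl⟩ := H.exists_mem_peakSet x hx
    have := hs.2 t ht
    rwa [H.height_of_mem ht, add_le_add_iff_right] at this

lemma freeBumps_add (w : List Step) : freeBumps w + (peakSet (shrink w)).val = bumps w :=
  tsub_add_cancel_of_le <| (Multiset.le_iff_subset (peakSet (shrink w)).nodup).2 fun _ =>
    mem_bumps_of_mem_peakSet_shrink

lemma card_peakSet_eq (w : List Step) :
    (peakSet w).card = (freeBumps w).card + (peakSet (shrink w)).card := by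
  rw [← card_bumps, ← freeBumps_add, Multiset.card_add, Finset.card_val]

lemma sum_bumps (w : List Step) :
    (bumps w).sum = (freeBumps w).sum + ∑ x ∈ peakSet (shrink w), x := by
  rw [← freeBumps_add, Multiset.sum_add, Finset.sum_val]
  rfl

lemma injOn_freeBumps_shrink :
    Set.InjOn (fun w => (freeBumps w, shrink w)) {w | Canonical w} := by
  intro w hw w' hw' he
  obtain ⟨hf, hs⟩ := Prod.mk.inj he
  exact eq_of_shrink_eq_of_bumps_eq hw hw' hs (by rw [← freeBumps_add, hf, hs, freeBumps_add])

lemma exists_freeBumps_eq_shrink_eq (s : Multiset ℕ) (hr : Canonical r) :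
    ∃ w, Canonical w ∧ freeBumps w = s ∧ shrink w = r := by
  obtain ⟨w, hw, rfl, hb⟩ := exists_shrink_eq_bumps_eq r (s + (peakSet r).val) hr fun x hx =>
    Multiset.mem_add.2 (Or.inr hx)
  exact ⟨w, hw, by rw [freeBumps, hb, add_tsub_cancel_right], rfl⟩

lemma stepAt_zero_of_mem_boundedWords_self (hw : w ∈ boundedWords h h) : stepAt w 0 = alpha := by
  refine eq_alpha_of_ne_beta fun h0 => ?_
  have := height_le_of_forall_mem_peakSet le_rfl hw.2 1
  rw [height_succ_of_beta h0, height_zero] at this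
  omega

lemma peakSet_of_stepAt_zero (h0 : stepAt w 0 = alpha) :
    peakSet w = (peakSet w.tail).map (addRightEmbedding 1) :=
  peakSet_of_one_notMem fun h1 => by simp [h0] at h1

lemma height_succ_of_stepAt_zero (h0 : stepAt w 0 = alpha) (x : ℕ) :
    height (h + 1) w (x + 1) = height h w.tail x := by
  rw [height_succ_eq_height_tail, h0, Step.move, Nat.add_sub_cancel]

lemma tail_mem_boundedWords (h0 : stepAt w 0 = alpha) (hw : Canonical w) :
    w.tail ∈ boundedWords (h + 1) h ↔ w ∈ boundedWords (h + 1) (h + 1) := by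
  simp [boundedWords, hw, hw.tail, peakSet_of_stepAt_zero h0, height_succ_of_stepAt_zero h0]

lemma bijOn_tail : Set.BijOn List.tail (boundedWords (h + 1) (h + 1)) (boundedWords (h + 1) h) := by
  refine ⟨fun w hw => ?_, fun w hw w' hw' he => ?_, fun r hr => ?_⟩
  · exact (tail_mem_boundedWords (stepAt_zero_of_mem_boundedWords_self hw) hw.1).2 hw
  · rw [← hw.1.scons_tail, ← hw'.1.scons_tail, he, stepAt_zero_of_mem_boundedWords_self hw,
      stepAt_zero_of_mem_boundedWords_self hw']
  · rw [← tail_scons alpha r] at hr ⊢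
    exact Set.mem_image_of_mem _ <|
      (tail_mem_boundedWords (stepAt_scons_zero _ _)
        (canonical_scons _ (tail_scons alpha r ▸ hr.1))).1 hr

/-- The start `(0, h + 1)` of the longer path is too high to bear on the charge of any peak. -/
lemma admissible_succ_iff_tail (h0 : stepAt w 0 = alpha) (hx : height h w.tail x ≤ h + 1) :
    Admissible (h + 1) w (x + 1) c ↔ Admissible h w.tail x c := by
  have hh := height_succ_of_stepAt_zero (h := h) h0
  have hmax (p q : ℕ) : IsLeftmostHighest (h + 1) w (p + 1) (x + 1) (q + 1) ↔
      IsLeftmostHighest h w.tail p x q := by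
    simp [IsLeftmostHighest, peakSet_of_stepAt_zero h0, hh]
  constructor
  · rintro ⟨hc, p, q, hp, hq, hhp, hhq, H⟩
    rw [hh] at hhp hhq
    obtain ⟨p, rfl⟩ := Nat.exists_eq_add_one_of_ne_zero
      (show p ≠ 0 by rintro rfl; rw [height_zero] at hhp; omega)
    obtain ⟨q, rfl⟩ := Nat.exists_eq_add_one_of_ne_zero (Nat.ne_zero_of_lt hq)
    rw [hh] at hhp hhq
    exact ⟨hc, p, q, by omega, by omega, hhp, hhq, (hmax p q).1 H⟩
  · rintro ⟨hc, p, q, hp, hq, hhp, hhq, H⟩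
    exact ⟨hc, p + 1, q + 1, by omega, by omega, by rwa [hh, hh], by rwa [hh, hh], (hmax p q).2 H⟩

lemma wordCharge_tail (hw : w ∈ boundedWords (h + 1) (h + 1)) :
    wordCharge (h + 1) w = wordCharge h w.tail := by
  have h0 := stepAt_zero_of_mem_boundedWords_self hw
  have hbound := ((tail_mem_boundedWords h0 hw.1).2 hw).2
  rw [wordCharge, peakSet_of_stepAt_zero h0, Finset.sum_map]
  refine Finset.sum_congr rfl fun x hx => ?_
  simp only [addRightEmbedding_apply, peakCharge, admissible_succ_iff_tail h0 (hbound x hx)]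

lemma encode_succ_of_le (ha : a ≤ h) (w : List Step) :
    encode (h + 1) a w = Fin.cons (freeBumps w) (encode h a (shrink w)) := by
  simp only [encode, if_pos ha, min_eq_left ha]

lemma encode_self (h : ℕ) (w : List Step) :
    encode (h + 1) (h + 1) w = encode (h + 1) h w.tail := by
  simp [encode]

theorem bijOn_encode (ha : a ≤ h) : Set.BijOn (encode h a) (boundedWords h a) Set.univ := by
  induction h generalizing a with
  | zero =>
    refine ⟨Set.mapsTo_univ _ _, fun w hw w' hw' _ => ?_, fun f _ => ?_⟩
    · rw [eq_nil_of_mem_boundedWords_zero hw, eq_nil_of_mem_boundedWords_zero hw']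
    · exact ⟨[], nil_mem_boundedWords 0 a, Subsingleton.elim _ _⟩
  | succ h ih =>
    have hle {a : ℕ} (ha : a ≤ h) :
        Set.BijOn (encode (h + 1) a) (boundedWords (h + 1) a) Set.univ := by
      refine ⟨Set.mapsTo_univ _ _, fun w hw w' hw' he => ?_, fun f _ => ?_⟩
      · rw [encode_succ_of_le ha, encode_succ_of_le ha] at he
        obtain ⟨hfree, hshrink⟩ := Fin.cons_injective2 he
        refine injOn_freeBumps_shrink hw.1 hw'.1 (Prod.ext hfree ?_)
        exact (ih ha).injOn ((shrink_mem_boundedWords ha hw.1).2 hw)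
          ((shrink_mem_boundedWords ha hw'.1).2 hw') hshrink
      · obtain ⟨r, hr, hrf⟩ := (ih ha).surjOn (Set.mem_univ (Fin.tail f))
        obtain ⟨w, hw, hfree, rfl⟩ := exists_freeBumps_eq_shrink_eq (f 0) hr.1
        refine ⟨w, (shrink_mem_boundedWords ha hw).1 hr, ?_⟩
        rw [encode_succ_of_le ha, hfree, hrf, Fin.cons_self_tail]
    obtain rfl | ha := ha.eq_or_lt
    · rw [funext (encode_self h)]
      exact (hle le_rfl).comp bijOn_tail
    · exact hle (Nat.le_of_lt_succ ha)

theorem boundedWords_induction {P : (h a : ℕ) → List Step → Prop} (zero : P 0 0 [])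
    (shrink : ∀ {h a w}, a ≤ h → w ∈ boundedWords (h + 1) a → P h a (shrink w) → P (h + 1) a w)
    (tail : ∀ {h w}, w ∈ boundedWords (h + 1) (h + 1) → P (h + 1) h w.tail →
      P (h + 1) (h + 1) w)
    (ha : a ≤ h) (hw : w ∈ boundedWords h a) : P h a w := by
  induction h generalizing a w with
  | zero =>
    obtain rfl := Nat.le_zero.1 ha
    rwa [eq_nil_of_mem_boundedWords_zero hw]
  | succ h ih =>
    have hle {a : ℕ} {w : List Step} (ha : a ≤ h) (hw : w ∈ boundedWords (h + 1) a) :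
        P (h + 1) a w :=
      shrink ha hw (ih ha ((shrink_mem_boundedWords ha hw.1).2 hw))
    obtain rfl | ha := ha.eq_or_lt
    · exact tail hw (hle le_rfl (bijOn_tail.mapsTo hw))
    · exact hle (Nat.le_of_lt_succ ha) hw

theorem card_peakSet_eq_sum_encode (ha : a ≤ h) (hw : w ∈ boundedWords h a) :
    (peakSet w).card = ∑ j, (encode h a w j).card := by
  refine boundedWords_induction (P := fun h a w => (peakSet w).card = ∑ j, (encode h a w j).card)
    rfl (fun {h a w} ha _ ih => ?_) (fun {h w} hw ih => ?_) ha hw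
  · rw [card_peakSet_eq, ih, encode_succ_of_le ha, Fin.sum_univ_succ]
    rfl
  · rw [peakSet_of_stepAt_zero (stepAt_zero_of_mem_boundedWords_self hw), Finset.card_map, ih,
      encode_self]

lemma tailCard_zero (f : Fin (h + 1) → Multiset ℕ) : tailCard f 0 = ∑ j, (f j).card := by
  rw [tailCard, ← bot_eq_zero, Finset.Ici_bot]

lemma tailCard_cons_succ (s : Multiset ℕ) (f : Fin h → Multiset ℕ) (j : Fin h) :
    tailCard (Fin.cons s f : Fin (h + 1) → Multiset ℕ) j.succ = tailCard f j := by
  rw [tailCard, Fin.sum_Ici_succ]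
  rfl

theorem wordCharge_eq_sum_tailCard (ha : a ≤ h) (hw : w ∈ boundedWords h a) :
    wordCharge a w = ∑ j, tailCard (encode h a w) j := by
  refine boundedWords_induction (P := fun h a w => wordCharge a w = ∑ j, tailCard (encode h a w) j)
    rfl (fun {h a w} ha hw ih => ?_) (fun {h w} hw ih => ?_) ha hw
  · rw [wordCharge_shrink, card_peakSet_eq_sum_encode (ha.trans h.le_succ) hw, ih,
      ← tailCard_zero, encode_succ_of_le ha, Fin.sum_univ_succ]
    simp only [tailCard_cons_succ]
  · rw [wordCharge_tail hw, ih, encode_self]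

lemma tupleWeight_cons (ha : a ≤ h) (s : Multiset ℕ) (f : Fin h → Multiset ℕ) :
    tupleWeight a (Fin.cons s f : Fin (h + 1) → Multiset ℕ) =
      s.sum + tailCard (Fin.cons s f : Fin (h + 1) → Multiset ℕ) 0 ^ 2 + tupleWeight a f := by
  rw [tupleWeight, Fin.sum_univ_succ, tupleWeight, if_neg (by simpa using Nat.lt_succ_of_le ha)]
  simp only [tailCard_cons_succ, Fin.cons_zero, Fin.cons_succ, Fin.val_succ, add_right_comm _ 1,
    add_le_add_iff_right, add_zero]

lemma tupleWeight_succ_self (f : Fin (h + 1) → Multiset ℕ) :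
    tupleWeight (h + 1) f = tupleWeight h f + tailCard f 0 := by
  have hpos (j : Fin h) : h + 1 ≤ (j : ℕ) + 1 + (h + 1) ∧ h + 1 ≤ (j : ℕ) + 1 + h := by omega
  simp only [tupleWeight, Fin.sum_univ_succ, Fin.val_zero, Fin.val_succ, zero_add, hpos, le_refl,
    (Nat.lt_succ_self h).not_ge, if_true, if_false]
  ring

theorem sum_peakSet_eq_tupleWeight (ha : a ≤ h) (hw : w ∈ boundedWords h a) :
    ∑ x ∈ peakSet w, x = tupleWeight a (encode h a w) := by
  refine boundedWords_induction
    (P := fun h a w => ∑ x ∈ peakSet w, x = tupleWeight a (encode h a w))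
    rfl (fun {h a w} ha hw ih => ?_) (fun {h w} hw ih => ?_) ha hw
  · rw [sum_peakSet, sum_bumps, ih, card_peakSet_eq_sum_encode (ha.trans h.le_succ) hw,
      ← tailCard_zero, encode_succ_of_le ha, tupleWeight_cons ha]
    ring
  · rw [peakSet_of_stepAt_zero (stepAt_zero_of_mem_boundedWords_self hw), Finset.sum_map]
    simp only [addRightEmbedding_apply, Finset.sum_add_distrib, Finset.sum_const, smul_eq_mul,
      mul_one]
    rw [ih, card_peakSet_eq_sum_encode h.le_succ (bijOn_tail.mapsTo hw), encode_self,
      tupleWeight_succ_self, tailCard_zero]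

end Encoding

/-! ### Restricted paths -/

/-- The path from `(0, a)` that follows `w` and then descends to the axis. -/
def completion (a : ℕ) (w : List Step) : List Step :=
  w ++ List.replicate (height a w w.length) alpha

lemma exists_eq_of_succ_le_add_one {f : ℕ → ℕ} {p q c : ℕ} (hf : ∀ x, f (x + 1) ≤ f x + 1)
    (hpq : p ≤ q) (hp : f p ≤ c) (hq : c ≤ f q) : ∃ r, p ≤ r ∧ r ≤ q ∧ f r = c := by
  induction q, hpq using Nat.le_induction with
  | base => exact ⟨p, le_rfl, le_rfl, hp.antisymm hq⟩
  | succ q hpq ih =>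
    rcases le_or_gt c (f q) with hc | hc
    · obtain ⟨r, hpr, hrq, hr⟩ := ih hc
      exact ⟨r, hpr, hrq.trans q.le_succ, hr⟩
    · exact ⟨q + 1, hpq.trans q.le_succ, le_rfl, ((hf q).trans hc).antisymm hq⟩

lemma exists_eq_of_le_succ_add_one {f : ℕ → ℕ} {p q c : ℕ} (hf : ∀ x, f x ≤ f (x + 1) + 1)
    (hpq : p ≤ q) (hp : c ≤ f p) (hq : f q ≤ c) : ∃ r, p ≤ r ∧ r ≤ q ∧ f r = c := by
  induction q, hpq using Nat.le_induction with
  | base => exact ⟨p, le_rfl, le_rfl, hq.antisymm hp⟩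
  | succ q hpq ih =>
    rcases le_or_gt (f q) c with hc | hc
    · obtain ⟨r, hpr, hrq, hr⟩ := ih hc
      exact ⟨r, hpr, hrq.trans q.le_succ, hr⟩
    · exact ⟨q + 1, hpq.trans q.le_succ, le_rfl, hq.antisymm (by have := hf q; omega)⟩

section Completion

variable {a h n x c : ℕ} {w v : List Step}

lemma stepAt_append_replicate (w : List Step) (n : ℕ) :
    stepAt (w ++ List.replicate n alpha) = stepAt w := by
  funext x
  rcases lt_or_ge x w.length with hx | hx
  · exact List.getD_append _ _ _ _ hx
  · rw [stepAt_of_length_le hx, stepAt, List.getD_append_right _ _ _ _ hx,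
      List.getD_eq_getElem?_getD]
    rcases lt_or_ge (x - w.length) n with hn | hn <;> simp [hn]

lemma exists_canonical_append_replicate (v : List Step) :
    ∃ w n, Canonical w ∧ w ++ List.replicate n alpha = v := by
  induction v using List.reverseRecOn with
  | nil => exact ⟨[], 0, canonical_nil, rfl⟩
  | append_singleton v s ih =>
    cases s with
    | alpha =>
      obtain ⟨w, n, hw, rfl⟩ := ih
      exact ⟨w, n + 1, hw, by rw [List.replicate_succ', List.append_assoc]⟩
    | beta => exact ⟨v ++ [beta], 0, by simp [Canonical], List.append_nil _⟩

lemma Canonical.length_le (hw : Canonical w) (h : stepAt w = stepAt v) :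
    w.length ≤ v.length := by
  rcases eq_or_ne w [] with rfl | hne
  · exact Nat.zero_le _
  · have hpeak := hw.length_mem_peakSet hne
    rw [peakSet_congr h, peakSet, Finset.mem_filter, Finset.mem_range] at hpeak
    exact Nat.le_of_lt_succ hpeak.1

lemma injOn_completion (a : ℕ) : Set.InjOn (completion a) {w | Canonical w} := by
  intro w hw v hv he
  have hstep : stepAt w = stepAt v := by
    rw [← stepAt_append_replicate w, ← stepAt_append_replicate v]
    exact congrArg stepAt he
  exact (List.append_inj he ((hw.length_le hstep).antisymm (hv.length_le hstep.symm))).1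

lemma pathHeight_eq_height (a : ℕ) (w : List Step) (hx : x ≤ w.length) :
    pathHeight a w x = height a w x := by
  induction x with
  | zero => rfl
  | succ x ih =>
    rw [height, ← ih (Nat.le_of_succ_le hx), pathHeight, List.take_add_one,
      List.getElem?_eq_getElem hx, List.foldl_append, stepAt, List.getD_eq_getElem _ _ hx]
    rfl

lemma pathHeight_append_replicate (a : ℕ) (w : List Step) (hx : x ≤ w.length + n) :
    pathHeight a (w ++ List.replicate n alpha) x = height a w x := by
  rw [pathHeight_eq_height _ _ (by simpa using hx), height_congr (stepAt_append_replicate w n)]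

lemma eq_height_of_isRestrictedPath (H : IsRestrictedPath a h (w ++ List.replicate n alpha)) :
    n = height a w w.length := by
  have hend := H.ends_on_axis
  rw [pathHeight_append_replicate _ _ (by simp), List.length_append, List.length_replicate,
    height_length_add] at hend
  cases n with
  | zero => exact hend.symm
  | succ n =>
    have hlast := H.last_not_horizontal (w.length + n) (by simp [add_assoc])
    rw [pathHeight_append_replicate _ _ (by omega), height_length_add] at hlast
    omega

lemma length_completion (a : ℕ) (w : List Step) :
    (completion a w).length = w.length + height a w w.length := by simp [completion]

lemma pathHeight_completion (hx : x ≤ (completion a w).length) :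
    pathHeight a (completion a w) x = height a w x :=
  pathHeight_append_replicate a w (length_completion a w ▸ hx)

lemma height_length_completion (a : ℕ) (w : List Step) :
    height a w (completion a w).length = 0 := by
  rw [length_completion, height_length_add, Nat.sub_self]

lemma lt_length_completion (a : ℕ) (hx : x ∈ peakSet w) : x < (completion a w).length := by
  have hlt := lt_length_of_stepAt_eq_beta (mem_peakSet.1 hx).2.1
  have hpos := height_of_mem_peakSet (a := a) hx
  rw [length_completion]
  rcases (show x ≤ w.length by omega).eq_or_lt with rfl | hlt <;> omega

lemma pathHeight_completion_of_mem_peakSet (hx : x ∈ peakSet w) :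
    pathHeight a (completion a w) x = height a w x :=
  pathHeight_completion (lt_length_completion a hx).le

lemma getElem?_eq_some_iff_stepAt {s : Step} (hx : x < w.length) :
    w[x]? = some s ↔ stepAt w x = s := by
  rw [stepAt, List.getD_eq_getElem _ _ hx, List.getElem?_eq_getElem hx, Option.some_inj]

lemma peaks_eq_filter_peakSet (w : List Step) : peaks w = {x ∈ peakSet w | x < w.length} := by
  ext x
  simp only [peaks, IsPeak, Finset.mem_filter, Finset.mem_range, mem_peakSet]
  rw [and_comm]
  refine and_congr_left fun hx => and_congr_right fun _ => ?_
  rw [getElem?_eq_some_iff_stepAt hx, getElem?_eq_some_iff_stepAt (by omega)]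

lemma peaks_completion (a : ℕ) (w : List Step) : peaks (completion a w) = peakSet w := by
  rw [peaks_eq_filter_peakSet, completion, peakSet_congr (stepAt_append_replicate _ _)]
  exact Finset.filter_true_of_mem fun x hx => lt_length_completion a hx

lemma chargeAdmissible_completion (hx : x ∈ peakSet w) (hc : 1 ≤ c) :
    ChargeAdmissible a (completion a w) x c ↔ Admissible a w x c := by
  have hlt := lt_length_completion a hx
  have hmax (p q : ℕ) : (∀ z ∈ peaks (completion a w), p < z → z < q → z ≠ x →
      pathHeight a (completion a w) z ≤ pathHeight a (completion a w) x ∧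
        (pathHeight a (completion a w) z = pathHeight a (completion a w) x → x < z)) ↔
      IsLeftmostHighest a w p x q := by
    rw [peaks_completion, IsLeftmostHighest]
    refine forall₂_congr fun z hz => ?_
    rw [pathHeight_completion_of_mem_peakSet hx, pathHeight_completion_of_mem_peakSet hz]
  simp only [ChargeAdmissible, hmax]
  constructor
  · rintro ⟨p, q, hpx, hxq, hq, hhp, hhq, H⟩
    rw [pathHeight_completion_of_mem_peakSet hx, pathHeight_completion (by omega)] at hhp hhq
    exact ⟨hc, p, q, hpx, hxq, hhp.le, hhq.le, H⟩
  · rintro ⟨-, p, q, hpx, hxq, hhp, hhq, H⟩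
    have hend := height_length_completion a w
    obtain ⟨p', hpp', hp'x, hp'⟩ := exists_eq_of_succ_le_add_one (c := height a w x - c)
      (height_succ_le a w) hpx.le (by omega) (by omega)
    obtain ⟨q', hxq', hq'q, hq'⟩ := exists_eq_of_le_succ_add_one (c := height a w x - c)
      (q := min q (completion a w).length) (height_le_succ a w) (le_min hxq.le hlt.le) (by omega)
      (by rcases min_choice q (completion a w).length with h | h <;> rw [h] <;> omega)
    obtain ⟨hq'q, hq'l⟩ := le_min_iff.1 hq'q
    have hne : p' ≠ x ∧ q' ≠ x := ⟨by rintro rfl; omega, by rintro rfl; omega⟩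
    refine ⟨p', q', by omega, by omega, hq'l, ?_, ?_, fun z hz hpz hzq =>
      H z hz (hpp'.trans_lt hpz) (hzq.trans_le hq'q)⟩ <;>
    rw [pathHeight_completion_of_mem_peakSet hx, pathHeight_completion (by omega)] <;> omega

lemma charge_completion (hx : x ∈ peakSet w) :
    charge a (completion a w) x = peakCharge a w x := by
  have hgreatest := isGreatest_peakCharge (a := a) hx
  refine IsGreatest.csSup_eq
    ⟨(chargeAdmissible_completion hx hgreatest.1.1).2 hgreatest.1, fun c hc => ?_⟩
  rcases Nat.eq_zero_or_pos c with rfl | hpos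
  · exact Nat.zero_le _
  · exact hgreatest.2 ((chargeAdmissible_completion hx hpos).1 hc)

lemma pathWeight_completion (a : ℕ) (w : List Step) :
    pathWeight (completion a w) = ∑ x ∈ peakSet w, x := by
  rw [pathWeight, peaks_completion]

lemma totalCharge_completion (a : ℕ) (w : List Step) :
    totalCharge a (completion a w) = wordCharge a w := by
  rw [totalCharge, wordCharge, peaks_completion]
  exact Finset.sum_congr rfl fun x hx => charge_completion hx

lemma Canonical.pathHeight_completion_ne_zero (hw : Canonical w)
    (hx : x + 1 = (completion a w).length) : pathHeight a (completion a w) x ≠ 0 := by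
  rw [pathHeight_completion (by omega)]
  rw [length_completion] at hx
  have hpos : 0 < height a w w.length := by
    by_contra! hzero
    have hpeak := hw.length_mem_peakSet (List.length_pos_iff.1 (by omega))
    have := height_of_mem_peakSet (a := a) hpeak
    omega
  obtain ⟨y, rfl⟩ := Nat.exists_eq_add_of_le (show w.length ≤ x by omega)
  rw [height_length_add]
  omega

lemma isRestrictedPath_completion (hw : Canonical w) :
    IsRestrictedPath a h (completion a w) ↔ w ∈ boundedWords h a := by
  have hpeaks : (∀ x ∈ peaks (completion a w), pathHeight a (completion a w) x ≤ h) ↔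
      ∀ x ∈ peakSet w, height a w x ≤ h := by
    rw [peaks_completion]
    exact forall₂_congr fun x hx => by rw [pathHeight_completion_of_mem_peakSet hx]
  refine ⟨fun H => ⟨hw, hpeaks.1 H.peak_le⟩, fun H => ⟨?_, fun x hx => ?_, hpeaks.2 H.2⟩⟩
  · rw [pathHeight_completion le_rfl, height_length_completion]
  · exact hw.pathHeight_completion_ne_zero hx

theorem bijOn_completion (h a : ℕ) :
    Set.BijOn (completion a) (boundedWords h a) {v | IsRestrictedPath a h v} := by
  refine ⟨fun w hw => (isRestrictedPath_completion hw.1).2 hw,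
    (injOn_completion a).mono fun w hw => hw.1, fun v hv => ?_⟩
  obtain ⟨w, n, hw, rfl⟩ := exists_canonical_append_replicate v
  obtain rfl := eq_height_of_isRestrictedPath hv
  exact ⟨w, (isRestrictedPath_completion hw).1 hv, rfl⟩

end Completion

/-! ### Multiple partitions -/

/-- Add to a list of numbers the smallest sequence with differences at least `g` and last term at
least `b`. -/
def spread (g b : ℕ) : List ℕ → List ℕ
  | [] => []
  | x :: l => (x + b + g * l.length) :: spread g b l

/-- The lower bound for the parts of `n^(j+1)` in a multiple partition with `c l` parts in
`n^(l+1)`. The subtraction `j + 2 - i` is truncated: it stands for `max (j + 2 - i, 0)`. -/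
def leastPart (i : ℕ) {h : ℕ} (c : Fin h → ℕ) (j : Fin h) : ℕ :=
  j + 1 + (j + 2 - i) + 2 * (j + 1) * ∑ l ∈ Finset.Ioi j, c l

/-- The multiple partition encoded by a tuple of multisets: each multiset, listed in decreasing
order, is spread out to meet the conditions of a multiple partition. -/
def toPartition (i : ℕ) {h : ℕ} (f : Fin h → Multiset ℕ) (j : Fin h) : List ℕ :=
  spread (2 * (j + 1)) (leastPart i (fun l => (f l).card) j) ((f j).sort (· ≥ ·))

section Spread

variable (g b : ℕ) {l p : List ℕ}

@[simp] lemma length_spread (l : List ℕ) : (spread g b l).length = l.length := by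
  induction l with
  | nil => rfl
  | cons x l ih => rw [spread, List.length_cons, ih, List.length_cons]

lemma sum_spread (l : List ℕ) :
    (spread g b l).sum = l.sum + b * l.length + g * l.length.choose 2 := by
  induction l with
  | nil => simp [spread]
  | cons x l ih =>
    rw [spread, List.sum_cons, ih, List.sum_cons, List.length_cons, Nat.choose_succ_succ',
      Nat.choose_one_right]
    ring

lemma spread_injective : Function.Injective (spread g b) := by
  intro l l' h
  induction l generalizing l' with
  | nil => cases l' with
    | nil => rfl
    | cons y l' => simp [spread] at h
  | cons x l ih => cases l' with
    | nil => simp [spread] at h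
    | cons y l' =>
      obtain ⟨hhead, htail⟩ := List.cons.inj h
      obtain rfl := ih htail
      rw [Nat.add_right_cancel (Nat.add_right_cancel hhead)]

variable {g b}

lemma isChain_spread :
    (spread g b l).IsChain (fun x y => x ≥ y + g) ↔ l.IsChain (· ≥ ·) := by
  induction l with
  | nil => simp [spread]
  | cons x l ih => cases l with
    | nil => simp [spread]
    | cons y l =>
      rw [List.isChain_cons_cons, ← ih, spread, spread, List.isChain_cons_cons, List.length_cons,
        mul_add_one]
      exact and_congr_left' (by omega)

lemma le_of_mem_getLast?_spread : ∀ x ∈ (spread g b l).getLast?, b ≤ x := by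
  induction l with
  | nil => simp [spread]
  | cons x l ih => cases l with
    | nil => simp [spread]
    | cons y l => simpa only [spread, List.getLast?_cons_cons] using ih

lemma exists_spread_eq (hp : p.IsChain (fun x y => x ≥ y + g))
    (hlast : ∀ x ∈ p.getLast?, b ≤ x) : ∃ l, spread g b l = p := by
  induction p with
  | nil => exact ⟨[], rfl⟩
  | cons x p ih => cases p with
    | nil => exact ⟨[x - b], by simp [spread, Nat.sub_add_cancel (hlast x rfl)]⟩
    | cons y p =>
      rw [List.isChain_cons_cons] at hp
      rw [List.getLast?_cons_cons] at hlast
      obtain ⟨l, hl⟩ := ih hp.2 hlast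
      cases l with
      | nil => simp [spread] at hl
      | cons z l =>
        refine ⟨(x - b - g * (z :: l).length) :: z :: l, ?_⟩
        have hy : z + b + g * l.length = y := (List.cons.inj hl).1
        rw [spread, hl, List.length_cons, mul_add_one]
        congr 1
        have := hp.1
        omega

theorem bijOn_spread_sort (g b : ℕ) :
    Set.BijOn (fun s : Multiset ℕ => spread g b (s.sort (· ≥ ·))) Set.univ
      {p | p.IsChain (fun x y => x ≥ y + g) ∧ ∀ x ∈ p.getLast?, b ≤ x} := by
  refine ⟨fun s _ => ⟨?_, le_of_mem_getLast?_spread⟩, fun s _ t _ h => ?_, fun p hp => ?_⟩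
  · exact isChain_spread.2 (s.pairwise_sort (· ≥ ·)).isChain
  · rw [← s.sort_eq (· ≥ ·), spread_injective g b h, t.sort_eq]
  · obtain ⟨l, rfl⟩ := exists_spread_eq hp.1 hp.2
    have hl := List.isChain_iff_pairwise.1 (isChain_spread.1 hp.1)
    exact ⟨l, trivial, congrArg (spread g b) (List.mergeSort_eq_self _ hl)⟩

end Spread

section MultiplePartitions

variable {k i h a : ℕ}

lemma leastPart_cast (i : ℕ) (c : Fin h → ℕ) (j : Fin h) :
    (leastPart i c j : ℤ) = ((j.val + 1 : ℕ) : ℤ) + max (((j.val + 1 : ℕ) : ℤ) - (i : ℤ) + 1) 0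
      + 2 * ((j.val + 1 : ℕ) : ℤ) * ((∑ l ∈ Finset.Ioi j, c l : ℕ) : ℤ) := by
  have hmax : max (((j.val + 1 : ℕ) : ℤ) - (i : ℤ) + 1) 0 = ((j.val + 2 - i : ℕ) : ℤ) := by omega
  rw [hmax, leastPart]
  push_cast
  ring

lemma isMultiplePartition_iff {p : Fin (k - 1) → List ℕ} :
    IsMultiplePartition k i p ↔ ∀ j, (p j).IsChain (fun x y => x ≥ y + 2 * (j.val + 1)) ∧
      ∀ x ∈ (p j).getLast?, leastPart i (fun l => (p l).length) j ≤ x := by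
  have hleast (j : Fin (k - 1)) (x : ℕ) := leastPart_cast i (fun l => (p l).length) j ▸
    Nat.cast_le (α := ℤ) (m := leastPart i (fun l => (p l).length) j) (n := x)
  exact ⟨fun H j => ⟨H.gap j, fun x hx => (hleast j x).1 (H.smallest j x hx)⟩,
    fun H => ⟨fun j => (H j).1, fun j x hx => (hleast j x).2 ((H j).2 x hx)⟩⟩

@[simp] lemma length_toPartition (i : ℕ) (f : Fin h → Multiset ℕ) (j : Fin h) :
    (toPartition i f j).length = (f j).card := by
  rw [toPartition, length_spread, Multiset.length_sort]

theorem bijOn_toPartition (k i : ℕ) :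
    Set.BijOn (toPartition i) Set.univ {p | IsMultiplePartition k i p} := by
  refine ⟨fun f _ => isMultiplePartition_iff.2 fun j => ?_, fun f _ f' _ he => ?_, fun p hp => ?_⟩
  · simp only [length_toPartition]
    exact (bijOn_spread_sort _ _).mapsTo trivial
  · have hcard : (fun l => (f l).card) = fun l => (f' l).card := by
      funext l
      rw [← length_toPartition i, he, length_toPartition]
    funext j
    have hj := congrFun he j
    rw [toPartition, toPartition, hcard] at hj
    exact (bijOn_spread_sort _ _).injOn trivial trivial hj
  · choose f _ hf using fun j => (bijOn_spread_sort _ _).surjOn (isMultiplePartition_iff.1 hp j)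
    have hcard : (fun l => (f l).card) = fun l => (p l).length := by
      funext l
      rw [← hf l, length_spread, Multiset.length_sort]
    exact ⟨f, trivial, funext fun j => by rw [toPartition, hcard, ← hf j]⟩

lemma two_mul_choose_two_add (n : ℕ) : 2 * n.choose 2 + n = n ^ 2 := by
  induction n with
  | zero => rfl
  | succ n ih =>
    rw [Nat.choose_succ_succ', Nat.choose_one_right]
    linarith

lemma sum_toPartition (i : ℕ) (f : Fin h → Multiset ℕ) (j : Fin h) :
    (toPartition i f j).sum = (f j).sum + (j + 2 - i) * (f j).card +
      (j + 1) * ((f j).card ^ 2 + 2 * (f j).card * ∑ l ∈ Finset.Ioi j, (f l).card) := by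
  have hsort : ((f j).sort (· ≥ ·)).sum = (f j).sum := by rw [← Multiset.sum_coe, Multiset.sort_eq]
  rw [toPartition, sum_spread, hsort, Multiset.length_sort, leastPart, ← two_mul_choose_two_add]
  ring

lemma sum_mul_sum_Ici {ι R : Type*} [Fintype ι] [Preorder ι] [LocallyFiniteOrderTop ι]
    [LocallyFiniteOrderBot ι] [NonUnitalNonAssocSemiring R] (c x : ι → R) :
    ∑ j, c j * ∑ l ∈ Finset.Ici j, x l = ∑ l, (∑ j ∈ Finset.Iic l, c j) * x l := by
  simp only [Finset.mul_sum, Finset.sum_mul]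
  exact Finset.sum_comm' (by simp)

lemma sum_sum_Ici (x : Fin h → ℕ) :
    ∑ j, ∑ l ∈ Finset.Ici j, x l = ∑ l : Fin h, (l + 1) * x l := by
  simpa using sum_mul_sum_Ici (fun _ => 1) x

lemma sq_sum {ι R : Type*} [LinearOrder ι] [CommSemiring R] (s : Finset ι) (x : ι → R) :
    (∑ l ∈ s, x l) ^ 2 = ∑ l ∈ s, (x l ^ 2 + 2 * x l * ∑ l' ∈ s with l < l', x l') := by
  induction s using Finset.induction_on_min with
  | empty => simp
  | insert m s hm ih =>
    have hnot : m ∉ s := fun h => (hm m h).false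
    have hfilter : ∑ l ∈ s, (x l ^ 2 + 2 * x l * ∑ l' ∈ insert m s with l < l', x l') =
        ∑ l ∈ s, (x l ^ 2 + 2 * x l * ∑ l' ∈ s with l < l', x l') :=
      Finset.sum_congr rfl fun l hl => by rw [Finset.filter_insert, if_neg (hm l hl).not_gt]
    rw [Finset.sum_insert hnot, Finset.sum_insert hnot, hfilter, ← ih, Finset.filter_insert,
      if_neg (lt_irrefl m), Finset.filter_true_of_mem hm]
    ring

lemma tailCard_sq (f : Fin h → Multiset ℕ) (j : Fin h) :
    tailCard f j ^ 2 = ∑ l ∈ Finset.Ici j,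
      ((f l).card ^ 2 + 2 * (f l).card * ∑ l' ∈ Finset.Ioi l, (f l').card) := by
  rw [tailCard, sq_sum]
  refine Finset.sum_congr rfl fun l hl => ?_
  congr 3
  ext l'
  simpa using fun hlt => (Finset.mem_Ici.1 hl).trans hlt.le

lemma sum_Iic_ite (ha : a ≤ h) (l : Fin h) :
    (∑ j ∈ Finset.Iic l, if h ≤ j + a then 1 else 0) = l + 1 + a - h := by
  have hIcc : {j ∈ Finset.Iic (l : ℕ) | h ≤ j + a} = Finset.Icc (h - a) l := by
    ext j
    simp only [Finset.mem_filter, Finset.mem_Iic, Finset.mem_Icc]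
    omega
  calc (∑ j ∈ Finset.Iic l, if h ≤ j + a then 1 else 0)
      = ∑ j ∈ Finset.Iic (l : ℕ), if h ≤ j + a then 1 else 0 := by
        rw [← Fin.map_valEmbedding_Iic, Finset.sum_map]
        rfl
    _ = l + 1 - (h - a) := by rw [← Finset.card_filter, hIcc, Nat.card_Icc]
    _ = l + 1 + a - h := by omega

lemma tupleWeight_eq (ha : a ≤ h) (f : Fin h → Multiset ℕ) :
    tupleWeight a f = ∑ j : Fin h, ((f j).sum + (j + 1 + a - h) * (f j).card +
      (j + 1) * ((f j).card ^ 2 + 2 * (f j).card * ∑ l ∈ Finset.Ioi j, (f l).card)) := by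
  have hlinear : (∑ j : Fin h, if h ≤ j + a then tailCard f j else 0) =
      ∑ l : Fin h, (l + 1 + a - h) * (f l).card := by
    simp only [← sum_Iic_ite ha, ← sum_mul_sum_Ici, ite_mul, one_mul, zero_mul, tailCard]
  simp only [tupleWeight, Finset.sum_add_distrib, hlinear, tailCard_sq, ← sum_sum_Ici]
  ring

lemma sum_sum_toPartition (hi : 1 ≤ i) (hik : i ≤ k) (f : Fin (k - 1) → Multiset ℕ) :
    ∑ j, (toPartition i f j).sum = tupleWeight (k - i) f := by
  rw [tupleWeight_eq (Nat.sub_le_sub_left hi k)]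
  refine Finset.sum_congr rfl fun j _ => ?_
  rw [sum_toPartition, show j.val + 1 + (k - i) - (k - 1) = j.val + 2 - i by omega]

lemma sum_mul_length_toPartition (i : ℕ) (f : Fin h → Multiset ℕ) :
    ∑ j : Fin h, (j + 1) * (toPartition i f j).length = ∑ j, tailCard f j := by
  simp only [length_toPartition, tailCard, sum_sum_Ici]

end MultiplePartitions

lemma finite_setOf_card_le_sum_le (m n : ℕ) :
    {s : Multiset ℕ | s.card ≤ m ∧ s.sum ≤ n}.Finite := by
  refine (Set.finite_Iic (m • Multiset.range (n + 1))).subset fun s hs => ?_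
  refine Multiset.le_iff_count.2 fun x => ?_
  rw [Multiset.count_nsmul]
  by_cases hx : x ∈ s
  · have hxn : x ∈ Multiset.range (n + 1) :=
      Multiset.mem_range.2 (Nat.lt_succ_of_le ((Multiset.le_sum_of_mem hx).trans hs.2))
    calc s.count x ≤ m * 1 := by rw [mul_one]; exact (s.count_le_card x).trans hs.1
      _ ≤ _ := Nat.mul_le_mul_left m (Multiset.one_le_count_iff_mem.2 hxn)
  · rw [Multiset.count_eq_zero_of_notMem hx]
    exact Nat.zero_le _

lemma finite_setOf_tupleWeight_eq (h a n m : ℕ) :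
    {f : Fin h → Multiset ℕ | tupleWeight a f = n ∧ ∑ j, tailCard f j = m}.Finite := by
  refine (Set.Finite.pi' fun _ => finite_setOf_card_le_sum_le m n).subset ?_
  rintro f ⟨rfl, rfl⟩ j
  constructor
  · calc (f j).card ≤ tailCard f j :=
          Finset.single_le_sum_of_canonicallyOrdered (f := fun l => (f l).card)
            (Finset.mem_Ici.2 le_rfl)
      _ ≤ ∑ j, tailCard f j := Finset.single_le_sum_of_canonicallyOrdered (Finset.mem_univ j)
  · calc (f j).sum ≤ (f j).sum + tailCard f j ^ 2 + if h ≤ j + a then tailCard f j else 0 :=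
          (Nat.le_add_right _ _).trans (Nat.le_add_right _ _)
      _ ≤ tupleWeight a f := Finset.single_le_sum_of_canonicallyOrdered
          (f := fun j : Fin h => (f j).sum + tailCard f j ^ 2 +
            if h ≤ j + a then tailCard f j else 0) (Finset.mem_univ j)

lemma bijOn_sep {α β : Type*} {φ : α → β} {s : Set α} {t : Set β} {P : α → Prop} {Q : β → Prop}
    (H : Set.BijOn φ s t) (hPQ : ∀ x ∈ s, P x ↔ Q (φ x)) :
    Set.BijOn φ {x ∈ s | P x} {y ∈ t | Q y} := by
  refine ⟨fun x hx => ⟨H.mapsTo hx.1, (hPQ x hx.1).1 hx.2⟩, H.injOn.mono (Set.sep_subset s P), ?_⟩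
  rintro y ⟨hy, hQ⟩
  obtain ⟨x, hx, rfl⟩ := H.surjOn hy
  exact ⟨x, ⟨hx, (hPQ x hx).2 hQ⟩, rfl⟩

end LatticePath

open LatticePath in
theorem proposition3 (k i n m : ℕ) (hi : 1 ≤ i) (hik : i ≤ k) :
    (restrictedPaths k i n m).Finite ∧ (multiplePartitions k i n m).Finite ∧
      numPaths k i n m = numMultiplePartitions k i n m := by
  have ha : k - i ≤ k - 1 := Nat.sub_le_sub_left hi k
  have hpaths : Set.BijOn (completion (k - i)) _ (restrictedPaths k i n m) :=
    bijOn_sep (bijOn_completion (k - 1) (k - i)) fun w _ => by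
      rw [pathWeight_completion, totalCharge_completion]
  have hwords :=
    bijOn_sep (P := fun w => ∑ x ∈ peakSet w, x = n ∧ wordCharge (k - i) w = m)
      (Q := fun f => tupleWeight (k - i) f = n ∧ ∑ j, tailCard f j = m)
      (bijOn_encode ha) fun w hw => by
        rw [sum_peakSet_eq_tupleWeight ha hw, wordCharge_eq_sum_tailCard ha hw]
  have hpartitions : Set.BijOn (toPartition i) _ (multiplePartitions k i n m) :=
    bijOn_sep (bijOn_toPartition k i) fun f _ => by
      rw [sum_sum_toPartition hi hik, sum_mul_length_toPartition]
  have hfinite := (finite_setOf_tupleWeight_eq (k - 1) (k - i) n m).subset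
    fun f (hf : f ∈ {f ∈ Set.univ | _}) => hf.2
  refine ⟨hpaths.finite_iff_finite.1 (hwords.finite_iff_finite.2 hfinite),
    hpartitions.finite_iff_finite.1 hfinite, ?_⟩
  exact hpaths.ncard_eq.symm.trans (hwords.ncard_eq.trans hpartitions.ncard_eq)
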